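/- **Conventions.** An *extended metric* on a set $Z$ is a map $\rho:Z\times Z\to[0,\infty]$ for which there is a set $\Omega(\rho)\subset Z$ with at most one element (the remote point $\omega$) such that $\rho$ is a (finite) metric on $Z\setminus\Omega(\rho)$, $\rho(z,\omega)=\rho(\omega,z)=\infty$ for $z\ne\omega$, and $\rho(\omega,\omega)=0$. It is *complete* if every Cauchy sequence in $Z\setminus\Omega(\rho)$ converges and $\Omega(\rho)\neq\emptyset$ whenever $Z\setminus\Omega(\rho)$ is unbounded. A quadruple in $Z^4$ is *admissible* if no entry occurs three or four times in it; its *cross ratio triple* is $$\mathrm{crt}_\rho(x,y,z,w)=(\rho(x,y)\rho(z,w):\rho(x,z)\rho(y,w):\rho(x,w)\rho(y,z))\in\mathbb{R}P^2,$$ where infinite factors are cancelled if the remote point occurs, so that $\mathrm{crt}_\rho(x,y,z,\omega)=(\rho(x,y):\rho(x,z):\rho(y,z))$ and $\mathrm{crt}_\rho(x,y,\omega,\omega)=(0:1:1)$, and likewise in the other positions. A map is *Möbius* if it is injective and preserves the cross ratio triples of all admissible quadruples; two extended metrics on $Z$ are *Möbius equivalent* if $\mathrm{id}_Z$ is Möbius.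 A *Möbius structure* $\mathcal{M}$ on $Z$ is an equivalence class of Möbius equivalent extended metrics, and a *Möbius space* $(Z,\mathcal{M})$ is a set $Z$ with $|Z|\ge 3$ and a Möbius structure on it. It is *complete* if $\rho\in\mathcal{M}$ is complete, and *ultrametric* if in each cross ratio triple $(a:b:c)$, $a,b,c\ge0$, the two largest entries coincide. Möbius spaces are *Möbius equivalent* if there is a bijective Möbius map between them. A *tree* is a metric space $(X,d)$ in which any two points $x,y$ are joined by a unique geodesic, with image $[x,y]$, and in which $[x,y]\cap[y,z]=\{y\}$ implies $[x,z]=[x,y]\cup[y,z]$. It is *geodesically complete* if every isometric map $[0,\ell]\to X$, $\ell>0$, extends to an isometric map $\mathbb{R}\to X$. Let $(x|y)_o=\frac12(d(o,x)+d(o,y)-d(x,y))$. The *boundary* $\partial_\infty X$ is the set of classes of sequences $(x_i)$ in $X$ with $(x_i|x_j)_o\to\infty$ as $i,j\to\infty$, where $(x_i)\sim(y_i)$ if $(x_i|y_i)_o\to\infty$; here $o\in X$ is any basepoint, on which these conditions do not depend. $X$ is *nonelementary* if $|\partial_\infty X|\ge3$. For classes $a=[(a_i)]$, $b=[(b_i)]$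 let $(a|b)_o=\lim_i(a_i|b_i)_o\in[0,\infty]$. The *canonical Möbius structure* $\mathcal{M}_X$ on $\partial_\infty X$ is the class of the metrics $\rho_o(a,b)=e^{-(a|b)_o}$, $o\in X$, which are pairwise Möbius equivalent. **Corollary 4.4.** Let $(Z,\mathcal{M})$ be a complete ultrametric Möbius space. If $X$ and $X'$ are nonelementary geodesically complete trees such that both $(\partial_\infty X,\mathcal{M}_X)$ and $(\partial_\infty X',\mathcal{M}_{X'})$ are Möbius equivalent to $(Z,\mathcal{M})$, then there is a bijective isometry $X\to X'$. -/

import Mathlib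

open Set Filter Topology
open scoped ENNReal LinearAlgebra.Projectivization

noncomputable section

namespace TreeMobius

universe u v

/-! ## Extended metrics and Möbius structures -/

/-- An extended metric on `Z`: a function `ρ : Z × Z → [0,∞]` and a set `remote` with at most one
element (the infinitely remote point), such that `ρ` is a finite metric off `remote`, such that
`ρ z ω = ∞` for `ω` remote and `z` not remote, and `ρ ω ω = 0`.  If `Z` has at least three points,
`remote` is determined by `ρ`. -/
structure ExtMetric (Z : Type u) where
  /-- the distance function -/
  d : Z → Z → ℝ≥0∞
  /-- the set of infinitely remote points (empty or a singleton) -/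
  remote : Set Z
  remote_subsingleton : remote.Subsingleton
  d_self : ∀ x, d x x = 0
  d_comm : ∀ x y, d x y = d y x
  eq_of_d_eq_zero : ∀ x y, d x y = 0 → x = y
  d_ne_top : ∀ x y, x ∉ remote → y ∉ remote → d x y ≠ ∞
  d_triangle : ∀ x y z, x ∉ remote → y ∉ remote → z ∉ remote → d x z ≤ d x y + d y z
  d_remote : ∀ z w, z ∉ remote → w ∈ remote → d z w = ∞

namespace ExtMetric

variable {Z : Type u}

/-- Completeness of an extended metric: Cauchy sequences of non-remote points converge
(necessarily to a non-remote point), and a remote point exists if the set of non-remote points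
is unbounded. -/
def IsComplete (ρ : ExtMetric Z) : Prop :=
  (∀ s : ℕ → Z, (∀ i, s i ∉ ρ.remote) →
    Tendsto (fun p : ℕ × ℕ => ρ.d (s p.1) (s p.2)) atTop (𝓝 0) →
      ∃ z, z ∉ ρ.remote ∧ Tendsto (fun i => ρ.d (s i) z) atTop (𝓝 0)) ∧
  ((¬ ∃ C : ℝ≥0∞, C ≠ ∞ ∧ ∀ x y, x ∉ ρ.remote → y ∉ ρ.remote → ρ.d x y ≤ C) →
    ρ.remote.Nonempty)

open Classical in
/-- The distance as a real number, with `∞` replaced by `1`.  In a cross ratio triple this gives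
the usual conventions for cancelling `∞`: if the remote point occurs once, each of the three
products has exactly one infinite factor, and if it occurs twice, one product is
`0` and both factors of the other two products are infinite, so that the triple is
`(0 : 1 : 1)` up to order. -/
def val (ρ : ExtMetric Z) (x y : Z) : ℝ := if ρ.d x y = ∞ then 1 else (ρ.d x y).toReal

theorem val_eq_zero_iff (ρ : ExtMetric Z) (x y : Z) : ρ.val x y = 0 ↔ x = y := by
  unfold val
  constructor
  · intro h
    split_ifs at h with h1
    · exact absurd h one_ne_zero
    rcases (ENNReal.toReal_eq_zero_iff _).1 h with h2 | h2
    · exact ρ.eq_of_d_eq_zero _ _ h2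
    · exact absurd h2 h1
  · rintro rfl
    simp [ρ.d_self]

end ExtMetric

/-- A quadruple is admissible if no entry occurs three or four times. -/
def Admissible {Z : Type u} (x y z w : Z) : Prop :=
  ¬ (x = y ∧ y = z) ∧ ¬ (x = y ∧ y = w) ∧ ¬ (x = z ∧ z = w) ∧ ¬ (y = z ∧ z = w)

theorem Admissible.map {Z : Type u} {Z' : Type v} {f : Z → Z'} (hf : Function.Injective f)
    {x y z w : Z} (h : Admissible x y z w) : Admissible (f x) (f y) (f z) (f w) := by
  simpa only [Admissible, hf.eq_iff] using h

/-- Homogeneous coordinates of the cross ratio triple. -/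
def crtVec {Z : Type u} (ρ : ExtMetric Z) (x y z w : Z) : Fin 3 → ℝ :=
  ![ρ.val x y * ρ.val z w, ρ.val x z * ρ.val y w, ρ.val x w * ρ.val y z]

theorem crtVec_ne_zero {Z : Type u} (ρ : ExtMetric Z) {x y z w : Z} (h : Admissible x y z w) :
    crtVec ρ x y z w ≠ 0 := by
  intro h0
  have h1 := congrFun h0 0
  have h2 := congrFun h0 1
  have h3 := congrFun h0 2
  simp only [crtVec, Matrix.cons_val, Pi.zero_apply, mul_eq_zero,
    ExtMetric.val_eq_zero_iff] at h1 h2 h3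
  unfold Admissible at h
  grind

/-- The cross ratio triple
`(ρ(x,y)ρ(z,w) : ρ(x,z)ρ(y,w) : ρ(x,w)ρ(y,z))` of an admissible quadruple, a point of the
real projective plane. -/
def crt {Z : Type u} (ρ : ExtMetric Z) (x y z w : Z) (h : Admissible x y z w) :
    ℙ ℝ (Fin 3 → ℝ) :=
  Projectivization.mk ℝ (crtVec ρ x y z w) (crtVec_ne_zero ρ h)

/-- A map between extended metric spaces is Möbius if it is injective and preserves the cross
ratio triples of all admissible quadruples. -/
def IsMobiusMap {Z : Type u} {Z' : Type v} (ρ : ExtMetric Z) (ρ' : ExtMetric Z') (f : Z → Z') :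
    Prop :=
  ∃ hf : Function.Injective f, ∀ (x y z w : Z) (h : Admissible x y z w),
    crt ρ' (f x) (f y) (f z) (f w) (h.map hf) = crt ρ x y z w h

/-- Two extended metrics on the same set are Möbius equivalent if the identity is Möbius. -/
def MobiusEquivMetric {Z : Type u} (ρ ρ' : ExtMetric Z) : Prop := IsMobiusMap ρ ρ' id

theorem MobiusEquivMetric.symm {Z : Type u} {ρ ρ' : ExtMetric Z} (h : MobiusEquivMetric ρ ρ') :
    MobiusEquivMetric ρ' ρ :=
  ⟨Function.injective_id, fun x y z w hq => (h.2 x y z w hq).symm⟩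

theorem MobiusEquivMetric.trans {Z : Type u} {ρ ρ' ρ'' : ExtMetric Z}
    (h : MobiusEquivMetric ρ ρ') (h' : MobiusEquivMetric ρ' ρ'') : MobiusEquivMetric ρ ρ'' :=
  ⟨Function.injective_id, fun x y z w hq => (h'.2 x y z w hq).trans (h.2 x y z w hq)⟩

theorem MobiusEquivMetric.refl {Z : Type u} (ρ : ExtMetric Z) : MobiusEquivMetric ρ ρ :=
  ⟨Function.injective_id, fun _ _ _ _ _ => rfl⟩

/-- A Möbius structure on `Z`: a nonempty set of pairwise Möbius equivalent extended metrics,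
maximal with respect to that property. -/
structure MobiusStructure (Z : Type u) where
  /-- the extended metrics of the structure -/
  metrics : Set (ExtMetric Z)
  nonempty : metrics.Nonempty
  equivalent : ∀ ρ ∈ metrics, ∀ ρ' ∈ metrics, MobiusEquivMetric ρ ρ'
  maximal : ∀ ρ, (∀ ρ' ∈ metrics, MobiusEquivMetric ρ' ρ) → ρ ∈ metrics

/-- A map between Möbius spaces is Möbius if it is injective and preserves the cross ratio
triple.  The cross ratio triple does not depend on the choice of metrics in the structures. -/
def MobiusStructure.IsMobius {Z : Type u} {Z' : Type v} (M : MobiusStructure Z)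
    (M' : MobiusStructure Z') (f : Z → Z') : Prop :=
  ∀ ρ ∈ M.metrics, ∀ ρ' ∈ M'.metrics, IsMobiusMap ρ ρ' f

/-- Two Möbius spaces are Möbius equivalent if there is a bijective Möbius map between them. -/
def MobiusStructure.Equivalent {Z : Type u} {Z' : Type v} (M : MobiusStructure Z)
    (M' : MobiusStructure Z') : Prop :=
  ∃ f : Z → Z', Function.Bijective f ∧ M.IsMobius M' f

/-- A point `(a : b : c)` with `a, b, c ≥ 0` is ultrametric if the two largest of the numbers
`a, b, c` coincide. -/
def IsUltrametricPoint (p : ℙ ℝ (Fin 3 → ℝ)) : Prop :=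
  ∃ (a b c : ℝ) (h : ![a, b, c] ≠ 0), 0 ≤ a ∧ 0 ≤ b ∧ 0 ≤ c ∧
    p = Projectivization.mk ℝ ![a, b, c] h ∧
    ((a ≤ b ∧ b = c) ∨ (b ≤ c ∧ c = a) ∨ (c ≤ a ∧ a = b))

/-- A Möbius structure is ultrametric if all its cross ratio triples are. -/
def MobiusStructure.IsUltrametric {Z : Type u} (M : MobiusStructure Z) : Prop :=
  ∀ ρ ∈ M.metrics, ∀ (x y z w : Z) (h : Admissible x y z w), IsUltrametricPoint (crt ρ x y z w h)

/-- A Möbius structure is complete if its extended metrics are complete (completeness is invariant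
under Möbius equivalence, so it does not matter which metric of the structure is taken). -/
def MobiusStructure.IsComplete {Z : Type u} (M : MobiusStructure Z) : Prop :=
  ∃ ρ ∈ M.metrics, ρ.IsComplete

/-! ## Trees -/

/-- `c` is a geodesic from `x` to `y`: an isometric map `[0, d(x,y)] → X` from `x` to `y`. -/
def IsGeodesic {X : Type u} [MetricSpace X] (x y : X) (c : Icc (0 : ℝ) (dist x y) → X) : Prop :=
  Isometry c ∧ c ⟨0, le_rfl, dist_nonneg⟩ = x ∧ c ⟨dist x y, dist_nonneg, le_rfl⟩ = y

/-- The geodesic segment `[x,y]`: the image of the geodesic from `x` to `y` (which is unique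
in a uniquely geodesic space). -/
def geodSegment {X : Type u} [MetricSpace X] (x y : X) : Set X :=
  {p | ∃ c, IsGeodesic x y c ∧ p ∈ range c}

/-- A (metric) tree: a uniquely geodesic metric space in which two segments `[x,y]`, `[y,z]` that
meet only in `y` form the segment `[x,z]`. -/
class IsMetricTree (X : Type u) [MetricSpace X] : Prop where
  existsUnique_geodesic : ∀ x y : X, ∃! c, IsGeodesic x y c
  segment_union : ∀ x y z : X, geodSegment x y ∩ geodSegment y z = {y} →
    geodSegment x z = geodSegment x y ∪ geodSegment y z

/-- A metric space is geodesically complete if every isometric map `[0,ℓ] → X` with `ℓ > 0`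
extends to an isometric map `ℝ → X`. -/
def IsGeodesicallyComplete (X : Type u) [MetricSpace X] : Prop :=
  ∀ (l : ℝ), 0 < l → ∀ c : Icc (0 : ℝ) l → X, Isometry c →
    ∃ g : ℝ → X, Isometry g ∧ ∀ t : Icc (0 : ℝ) l, g t = c t

/-- The Gromov product `(x|y)_o`. -/
def gprod {X : Type u} [MetricSpace X] (o x y : X) : ℝ :=
  (dist o x + dist o y - dist x y) / 2

/-- `s` is a Gromov sequence: `(s i | s j)_o → ∞` as `i, j → ∞`, for some basepoint `o`. -/
def IsGromovSeq {X : Type u} [MetricSpace X] (s : ℕ → X) : Prop :=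
  ∃ o : X, Tendsto (fun p : ℕ × ℕ => gprod o (s p.1) (s p.2)) atTop atTop

section TreeFacts

variable {X : Type u} [MetricSpace X]

theorem gprod_comm (o x y : X) : gprod o x y = gprod o y x := by
  unfold gprod; rw [dist_comm x y]; ring

theorem gprod_nonneg (o x y : X) : 0 ≤ gprod o x y := by
  unfold gprod
  have := dist_triangle x o y
  rw [dist_comm x o] at this
  linarith

theorem gprod_le_left (o x y : X) : gprod o x y ≤ dist o x := by
  unfold gprod
  have := dist_triangle o x y
  linarith

theorem gprod_base (o o' x y : X) : gprod o x y ≤ gprod o' x y + dist o o' := by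
  unfold gprod
  have h1 := dist_triangle o o' x
  have h2 := dist_triangle o o' y
  linarith

/-- Divergence of Gromov products does not depend on the basepoint. -/
theorem tendsto_gprod_base {ι : Type v} {l : Filter ι} {s t : ι → X} {o : X} (o' : X)
    (h : Tendsto (fun i => gprod o (s i) (t i)) l atTop) :
    Tendsto (fun i => gprod o' (s i) (t i)) l atTop := by
  have h2 := tendsto_atTop_add_const_right l (-dist o o') h
  refine tendsto_atTop_mono (fun i => ?_) h2
  have := gprod_base o o' (s i) (t i)
  linarith

theorem IsGromovSeq.tendsto {s : ℕ → X} (hs : IsGromovSeq s) (o : X) :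
    Tendsto (fun p : ℕ × ℕ => gprod o (s p.1) (s p.2)) atTop atTop := by
  obtain ⟨o', h⟩ := hs
  exact tendsto_gprod_base o h

theorem IsGromovSeq.exists_forall {s : ℕ → X} (hs : IsGromovSeq s) (o : X) (C : ℝ) :
    ∃ N, ∀ i ≥ N, ∀ j ≥ N, C < gprod o (s i) (s j) := by
  have h := (hs.tendsto o).eventually (eventually_gt_atTop C)
  obtain ⟨⟨a, b⟩, hab⟩ := eventually_atTop.1 h
  exact ⟨max a b, fun i hi j hj => hab (i, j) ⟨le_trans (le_max_left _ _) hi,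
    le_trans (le_max_right _ _) hj⟩⟩

variable [IsMetricTree X]

theorem mem_geodSegment_iff {x y p : X} :
    p ∈ geodSegment x y ↔ dist x p + dist p y = dist x y := by
  constructor
  · rintro ⟨c, ⟨hc, h0, h1⟩, ⟨⟨t, ht0, ht1⟩, rfl⟩⟩
    have e1 := hc.dist_eq ⟨0, le_rfl, dist_nonneg⟩ ⟨t, ht0, ht1⟩
    have e2 := hc.dist_eq ⟨t, ht0, ht1⟩ ⟨dist x y, dist_nonneg, le_rfl⟩
    rw [h0] at e1
    rw [h1] at e2
    rw [e1, e2, Subtype.dist_eq, Subtype.dist_eq, Real.dist_eq, Real.dist_eq,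
      abs_of_nonpos (by simpa using ht0), abs_of_nonpos (by simpa using ht1)]
    ring
  · intro h
    obtain ⟨c₁, ⟨i₁, a₁, b₁⟩, -⟩ := IsMetricTree.existsUnique_geodesic x p
    obtain ⟨c₂, ⟨i₂, a₂, b₂⟩, -⟩ := IsMetricTree.existsUnique_geodesic p y
    have hm₂ : ∀ t : Icc (0 : ℝ) (dist x y), ¬ (t : ℝ) ≤ dist x p →
        (t : ℝ) - dist x p ∈ Icc (0 : ℝ) (dist p y) := by
      intro t ht
      have := t.2.2
      exact ⟨by linarith, by linarith⟩
    let c : Icc (0 : ℝ) (dist x y) → X := fun t =>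
      if ht : (t : ℝ) ≤ dist x p then c₁ ⟨t, t.2.1, ht⟩ else c₂ ⟨t - dist x p, hm₂ t ht⟩
    have key : ∀ s t : Icc (0 : ℝ) (dist x y), (s : ℝ) ≤ t → dist (c s) (c t) = t - s := by
      intro s t hst
      have hs0 := s.2.1
      have ht1 := t.2.2
      by_cases ht : (t : ℝ) ≤ dist x p
      · have hs : (s : ℝ) ≤ dist x p := hst.trans ht
        simp only [c, dif_pos hs, dif_pos ht]
        rw [i₁.dist_eq, Subtype.dist_eq, Real.dist_eq, abs_of_nonpos (by simpa using hst)]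
        simp
      · by_cases hs : (s : ℝ) ≤ dist x p
        · simp only [c, dif_pos hs, dif_neg ht]
          have e1 := i₁.dist_eq ⟨s, hs0, hs⟩ ⟨dist x p, dist_nonneg, le_rfl⟩
          have e0 := i₁.dist_eq ⟨0, le_rfl, dist_nonneg⟩ ⟨s, hs0, hs⟩
          have e2 := i₂.dist_eq ⟨0, le_rfl, dist_nonneg⟩ ⟨t - dist x p, hm₂ t ht⟩
          have e3 := i₂.dist_eq ⟨t - dist x p, hm₂ t ht⟩ ⟨dist p y, dist_nonneg, le_rfl⟩
          rw [b₁, Subtype.dist_eq, Real.dist_eq, abs_of_nonpos (by simpa using hs)] at e1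
          rw [a₁, Subtype.dist_eq, Real.dist_eq, abs_of_nonpos (by simpa using hs0)] at e0
          rw [a₂, Subtype.dist_eq, Real.dist_eq,
            abs_of_nonpos (by simpa using (hm₂ t ht).1)] at e2
          rw [b₂, Subtype.dist_eq, Real.dist_eq,
            abs_of_nonpos (by simpa using (hm₂ t ht).2)] at e3
          simp only at e0 e1 e2 e3
          have t1 := dist_triangle (c₁ ⟨s, hs0, hs⟩) p (c₂ ⟨t - dist x p, hm₂ t ht⟩)
          have t2 := dist_triangle4 x (c₁ ⟨s, hs0, hs⟩) (c₂ ⟨t - dist x p, hm₂ t ht⟩) y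
          linarith
        · simp only [c, dif_neg hs, dif_neg ht]
          rw [i₂.dist_eq, Subtype.dist_eq, Real.dist_eq, abs_of_nonpos (by simpa using hst)]
          simp
    have hc : Isometry c := by
      refine Isometry.of_dist_eq fun s t => ?_
      rw [Subtype.dist_eq, Real.dist_eq]
      rcases le_total (s : ℝ) t with hst | hst
      · rw [key s t hst, abs_of_nonpos (by linarith)]; ring
      · rw [dist_comm, key t s hst, abs_of_nonneg (by linarith)]
    have hc0 : c ⟨0, le_rfl, dist_nonneg⟩ = x := by
      simp only [c, dif_pos (dist_nonneg : (0 : ℝ) ≤ dist x p)]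
      exact a₁
    have hcp : c ⟨dist x p, dist_nonneg, by linarith [dist_nonneg (x := p) (y := y)]⟩ = p := by
      simp only [c, le_refl, dif_pos]
      exact b₁
    have hc1 : c ⟨dist x y, dist_nonneg, le_rfl⟩ = y := by
      by_cases hy : dist x y ≤ dist x p
      · have : dist p y = 0 := le_antisymm (by linarith) dist_nonneg
        have hpy : p = y := dist_eq_zero.1 this
        subst hpy
        exact hcp
      · simp only [c, dif_neg hy]
        refine Eq.trans ?_ b₂
        congr 2
        linarith
    exact ⟨c, ⟨hc, hc0, hc1⟩, ⟨_, hcp⟩⟩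

theorem dist_of_mem_geodSegment {x y p q : X} (hp : p ∈ geodSegment x y)
    (hq : q ∈ geodSegment x y) (hpq : dist x p ≤ dist x q) : dist x p + dist p q = dist x q := by
  obtain ⟨c, ⟨hc, h0, h1⟩, ⟨⟨s, hs0, hs1⟩, rfl⟩⟩ := hp
  obtain ⟨c', hc', ⟨⟨t, ht0, ht1⟩, rfl⟩⟩ := hq
  obtain rfl : c' = c :=
    (IsMetricTree.existsUnique_geodesic x y).unique hc' ⟨hc, h0, h1⟩
  have e1 := hc.dist_eq ⟨0, le_rfl, dist_nonneg⟩ ⟨s, hs0, hs1⟩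
  have e2 := hc.dist_eq ⟨0, le_rfl, dist_nonneg⟩ ⟨t, ht0, ht1⟩
  rw [h0, Subtype.dist_eq, Real.dist_eq, abs_of_nonpos (by simpa using hs0)] at e1
  rw [h0, Subtype.dist_eq, Real.dist_eq, abs_of_nonpos (by simpa using ht0)] at e2
  simp only at e1 e2
  rw [hc.dist_eq, e1, e2, Subtype.dist_eq, Real.dist_eq, abs_of_nonpos (by simp only; linarith)]
  simp only
  ring

/-- The tripod of three points. -/
theorem exists_tripod (o x y : X) : ∃ p, p ∈ geodSegment o x ∧ p ∈ geodSegment o y ∧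
    dist o p = gprod o x y := by
  have hcpt : ∀ z : X, IsCompact (geodSegment o z) := by
    intro z
    obtain ⟨c, hc, hu⟩ := IsMetricTree.existsUnique_geodesic o z
    have : geodSegment o z = range c := by
      ext q
      constructor
      · rintro ⟨c', hc', hq⟩
        rwa [← hu c' hc']
      · exact fun hq => ⟨c, hc, hq⟩
    rw [this]
    exact isCompact_range hc.1.continuous
  have hne : (geodSegment o x ∩ geodSegment o y).Nonempty :=
    ⟨o, mem_geodSegment_iff.2 (by simp), mem_geodSegment_iff.2 (by simp)⟩
  obtain ⟨p, ⟨hpx, hpy⟩, hmax⟩ := ((hcpt x).inter (hcpt y)).exists_isMaxOn hne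
    (f := fun q => dist o q) (by fun_prop)
  refine ⟨p, hpx, hpy, ?_⟩
  rw [mem_geodSegment_iff] at hpx hpy
  have hint : geodSegment x p ∩ geodSegment p y = {p} := by
    ext q
    constructor
    · rintro ⟨h1, h2⟩
      rw [mem_geodSegment_iff] at h1 h2
      have t1 := dist_triangle o p q
      have t2 := dist_triangle o q x
      have t3 := dist_triangle o q y
      have e1 := dist_comm x q
      have e2 := dist_comm q p
      have e3 := dist_comm x p
      have := hmax (a := q) ⟨mem_geodSegment_iff.2 (by linarith),
        mem_geodSegment_iff.2 (by linarith)⟩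
      simp only [mem_ofPred_eq] at this
      have hd : dist q p = 0 := le_antisymm (by linarith) dist_nonneg
      exact dist_eq_zero.1 hd
    · rintro rfl
      exact ⟨mem_geodSegment_iff.2 (by simp), mem_geodSegment_iff.2 (by simp)⟩
  have hp : p ∈ geodSegment x y := by
    rw [IsMetricTree.segment_union x p y hint]
    exact Or.inl (mem_geodSegment_iff.2 (by simp))
  rw [mem_geodSegment_iff] at hp
  have e3 := dist_comm x p
  unfold gprod
  linarith

/-- Trees are `0`-hyperbolic. -/
theorem min_gprod_le (o x y z : X) :
    min (gprod o x y) (gprod o y z) ≤ gprod o x z := by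
  have main : ∀ x z : X, gprod o x y ≤ gprod o y z → gprod o x y ≤ gprod o x z := by
    intro x z h
    obtain ⟨p, hpx, hpy, hp⟩ := exists_tripod o x y
    obtain ⟨q, hqy, hqz, hq⟩ := exists_tripod o y z
    have e := dist_of_mem_geodSegment hpy hqy (by rw [hp, hq]; exact h)
    rw [mem_geodSegment_iff] at hpx hqz
    have t1 := dist_triangle p q z
    have t2 := dist_triangle x p z
    have e1 := dist_comm x p
    rw [← hp]
    unfold gprod
    linarith
  rcases le_total (gprod o x y) (gprod o y z) with h | h
  · exact (min_le_left _ _).trans (main x z h)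
  · refine (min_le_right _ _).trans ?_
    have := main z x (by rwa [gprod_comm o z y, gprod_comm o y x])
    rwa [gprod_comm o z y, gprod_comm o z x] at this

variable (X) in
/-- Equivalence of Gromov sequences: `(s i | t i)_o → ∞` for some basepoint `o`. -/
def gromovSetoid : Setoid {s : ℕ → X // IsGromovSeq s} where
  r s t := ∃ o : X, Tendsto (fun i => gprod o (s.1 i) (t.1 i)) atTop atTop
  iseqv :=
    { refl := fun s => by
        obtain ⟨o, h⟩ := s.2
        exact ⟨o, h.comp (tendsto_id.prodMk tendsto_id |>.mono_right
          (by rw [← prod_atTop_atTop_eq]))⟩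
      symm := fun {s t} ⟨o, h⟩ => ⟨o, by simpa only [gprod_comm] using h⟩
      trans := fun {r s t} ⟨o, h⟩ ⟨o', h'⟩ => ⟨o, by
        have h2 := tendsto_gprod_base o h'
        refine tendsto_atTop.2 fun C => ?_
        filter_upwards [h.eventually_ge_atTop C, h2.eventually_ge_atTop C] with i h3 h4
        exact (le_min h3 h4).trans (min_gprod_le o _ _ _)⟩ }

end TreeFacts

/-- The boundary at infinity of a tree: equivalence classes of Gromov sequences. -/
def Boundary (X : Type u) [MetricSpace X] [IsMetricTree X] : Type u := Quotient (gromovSetoid X)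

/-- A tree is nonelementary if its boundary has at least three points. -/
def IsNonelementary (X : Type u) [MetricSpace X] [IsMetricTree X] : Prop :=
  3 ≤ Cardinal.mk (Boundary X)

section BoundaryMetric

variable {X : Type u} [MetricSpace X] [IsMetricTree X]

/-- A Gromov sequence representing a boundary point. -/
def Boundary.seq (a : Boundary X) : ℕ → X := (Quotient.out a).1

/-- The Gromov product `(a|b)_o = lim (a i | b i)_o ∈ [0,∞]` of boundary points, where `a i → a`
and `b i → b` (it is infinite if `a = b`).  By `tendsto_bgprod`, the limit exists and does not
depend on the representing sequences. -/
def bgprod (o : X) (a b : Boundary X) : EReal :=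
  limUnder atTop (fun i => ((gprod o (a.seq i) (b.seq i) : ℝ) : EReal))

/-- Either `(s i | t i)_o → ∞` or `(s i | t i)_o` is eventually constant. -/
theorem tendsto_or_eventually_const {s t : ℕ → X} (hs : IsGromovSeq s) (ht : IsGromovSeq t)
    (o : X) : Tendsto (fun i => gprod o (s i) (t i)) atTop atTop ∨
      ∃ L : ℝ, ∀ᶠ i in atTop, gprod o (s i) (t i) = L := by
  by_cases h : Tendsto (fun i => gprod o (s i) (t i)) atTop atTop
  · exact Or.inl h
  right
  simp only [tendsto_atTop, not_forall] at h
  obtain ⟨C, hC⟩ := h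
  rw [not_eventually] at hC
  obtain ⟨N₁, h₁⟩ := hs.exists_forall o C
  obtain ⟨N₂, h₂⟩ := ht.exists_forall o C
  obtain ⟨n, hn, hlt⟩ := (frequently_atTop.1 hC) (max N₁ N₂)
  rw [not_le] at hlt
  have hn₁ := (le_max_left _ _).trans hn
  have hn₂ := (le_max_right _ _).trans hn
  refine ⟨gprod o (s n) (t n), eventually_atTop.2 ⟨max N₁ N₂, fun i hi => ?_⟩⟩
  have hi₁ := (le_max_left _ _).trans hi
  have hi₂ := (le_max_right _ _).trans hi
  have a1 := h₁ n hn₁ i hi₁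
  have a2 := h₂ n hn₂ i hi₂
  have c1 := gprod_comm o (s n) (s i)
  have c2 := gprod_comm o (t n) (t i)
  have b1 := min_gprod_le o (s n) (s i) (t i)
  have b2 := min_gprod_le o (s n) (t i) (t n)
  have b3 := min_gprod_le o (s i) (s n) (t n)
  have b4 := min_gprod_le o (s i) (t n) (t i)
  simp only [min_le_iff] at b1 b2 b3 b4
  apply le_antisymm
  · rcases b2 with b2 | b2
    · rcases b1 with b1 | b1 <;> linarith
    · linarith
  · rcases b4 with b4 | b4
    · rcases b3 with b3 | b3 <;> linarith
    · linarith

theorem exists_tendsto_gprod {s t : ℕ → X} (hs : IsGromovSeq s) (ht : IsGromovSeq t) (o : X) :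
    ∃ L : EReal, Tendsto (fun i => ((gprod o (s i) (t i) : ℝ) : EReal)) atTop (𝓝 L) := by
  rcases tendsto_or_eventually_const hs ht o with h | ⟨L, h⟩
  · exact ⟨⊤, EReal.tendsto_coe_nhds_top_iff.2 h⟩
  · refine ⟨L, tendsto_const_nhds.congr' ?_⟩
    filter_upwards [h] with i hi
    rw [hi]

theorem tendsto_bgprod_seq (o : X) (a b : Boundary X) :
    Tendsto (fun i => ((gprod o (a.seq i) (b.seq i) : ℝ) : EReal)) atTop (𝓝 (bgprod o a b)) :=
  tendsto_nhds_limUnder (exists_tendsto_gprod (Quotient.out a).2 (Quotient.out b).2 o)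

/-- The Gromov product of boundary points is the limit of the Gromov products along arbitrary
representing sequences. -/
theorem tendsto_bgprod (o : X) (s t : {s : ℕ → X // IsGromovSeq s}) :
    Tendsto (fun i => ((gprod o (s.1 i) (t.1 i) : ℝ) : EReal)) atTop
      (𝓝 (bgprod o (Quotient.mk (gromovSetoid X) s) (Quotient.mk (gromovSetoid X) t))) := by
  obtain ⟨L, hL⟩ := exists_tendsto_gprod s.2 t.2 o
  have h0 := tendsto_bgprod_seq o (Quotient.mk (gromovSetoid X) s) (Quotient.mk (gromovSetoid X) t)
  have key : ∀ s : {s : ℕ → X // IsGromovSeq s}, Tendsto (fun i =>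
      ((gprod o (Boundary.seq (Quotient.mk (gromovSetoid X) s) i) (s.1 i) : ℝ) : EReal))
        atTop (𝓝 ⊤) := by
    intro s
    obtain ⟨o', h⟩ := Quotient.mk_out (s := gromovSetoid X) s
    exact EReal.tendsto_coe_nhds_top_iff.2 (tendsto_gprod_base o h)
  have hs := key s
  have ht := key t
  have h1 : L ≤ bgprod o (Quotient.mk (gromovSetoid X) s) (Quotient.mk (gromovSetoid X) t) := by
    have := ((hs.min hL).min ht)
    simp only [le_top, inf_of_le_left, inf_of_le_right] at this
    refine le_of_tendsto_of_tendsto' this h0 fun i => ?_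
    have b1 := min_gprod_le o (Boundary.seq (Quotient.mk (gromovSetoid X) s) i) (s.1 i) (t.1 i)
    have b2 := min_gprod_le o (Boundary.seq (Quotient.mk (gromovSetoid X) s) i) (t.1 i)
      (Boundary.seq (Quotient.mk (gromovSetoid X) t) i)
    rw [gprod_comm o (t.1 i)] at b2
    rw [← EReal.coe_strictMono.monotone.map_min, ← EReal.coe_strictMono.monotone.map_min]
    exact_mod_cast (min_le_min_right _ b1).trans b2
  have h2 : bgprod o (Quotient.mk (gromovSetoid X) s) (Quotient.mk (gromovSetoid X) t) ≤ L := by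
    have := ((hs.min h0).min ht)
    simp only [le_top, inf_of_le_left, inf_of_le_right] at this
    refine le_of_tendsto_of_tendsto' this hL fun i => ?_
    have b1 := min_gprod_le o (s.1 i) (Boundary.seq (Quotient.mk (gromovSetoid X) s) i)
      (Boundary.seq (Quotient.mk (gromovSetoid X) t) i)
    have b2 := min_gprod_le o (s.1 i) (Boundary.seq (Quotient.mk (gromovSetoid X) t) i) (t.1 i)
    rw [gprod_comm o (s.1 i)] at b1
    rw [← EReal.coe_strictMono.monotone.map_min, ← EReal.coe_strictMono.monotone.map_min]
    exact_mod_cast (min_le_min_right _ b1).trans b2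
  rwa [le_antisymm h2 h1]

theorem bgprod_comm (o : X) (a b : Boundary X) : bgprod o a b = bgprod o b a := by
  unfold bgprod
  simp only [gprod_comm o (a.seq _)]

theorem bgprod_nonneg (o : X) (a b : Boundary X) : 0 ≤ bgprod o a b :=
  ge_of_tendsto' (tendsto_bgprod_seq o a b) fun i => by exact_mod_cast gprod_nonneg o _ _

theorem min_bgprod_le (o : X) (a b c : Boundary X) :
    min (bgprod o a b) (bgprod o b c) ≤ bgprod o a c :=
  le_of_tendsto_of_tendsto' ((tendsto_bgprod_seq o a b).min (tendsto_bgprod_seq o b c))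
    (tendsto_bgprod_seq o a c) fun i => by
      rw [← EReal.coe_strictMono.monotone.map_min]
      exact_mod_cast min_gprod_le o _ _ _

theorem bgprod_eq_top_iff (o : X) (a b : Boundary X) : bgprod o a b = ⊤ ↔ a = b := by
  constructor
  · intro h
    have h1 := tendsto_bgprod_seq o a b
    rw [h, EReal.tendsto_coe_nhds_top_iff] at h1
    rw [← Quotient.out_eq a, ← Quotient.out_eq b]
    exact Quotient.sound ⟨o, h1⟩
  · rintro rfl
    obtain ⟨o', h⟩ := (gromovSetoid X).refl (Quotient.out a)
    exact tendsto_nhds_unique (tendsto_bgprod_seq o a a)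
      (EReal.tendsto_coe_nhds_top_iff.2 (tendsto_gprod_base o h))

/-- The Bourdon metric `ρ_o(a,b) = e^{-(a|b)_o}` on the boundary of a tree. -/
def bourdon (o : X) : ExtMetric (Boundary X) where
  d a b := EReal.exp (-bgprod o a b)
  remote := ∅
  remote_subsingleton := subsingleton_empty
  d_self a := by simp [(bgprod_eq_top_iff o a a).2 rfl]
  d_comm a b := by rw [bgprod_comm]
  eq_of_d_eq_zero a b h := by
    rw [EReal.exp_eq_zero_iff, EReal.neg_eq_bot_iff] at h
    exact (bgprod_eq_top_iff o a b).1 h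
  d_ne_top a b _ _ h := by
    rw [EReal.exp_eq_top_iff, EReal.neg_eq_top_iff] at h
    have := bgprod_nonneg o a b
    rw [h] at this
    simp at this
  d_triangle a b c _ _ _ := by
    rcases min_le_iff.1 (min_bgprod_le o a b c) with h | h
    · exact (EReal.exp_monotone (EReal.neg_le_neg_iff.2 h)).trans le_self_add
    · exact (EReal.exp_monotone (EReal.neg_le_neg_iff.2 h)).trans le_add_self
  d_remote _ _ _ h := absurd h (notMem_empty _)

theorem tendsto_bourdon (o : X) (a b : Boundary X) :
    Tendsto (fun i => Real.exp (-gprod o (a.seq i) (b.seq i))) atTop (𝓝 ((bourdon o).val a b)) := by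
  have hne : (bourdon o).d a b ≠ ∞ :=
    (bourdon o).d_ne_top a b (notMem_empty _) (notMem_empty _)
  have hval : (bourdon o).val a b = ((bourdon o).d a b).toReal := by
    simp [ExtMetric.val, hne]
  rw [hval]
  have h1 : Tendsto (fun i => EReal.exp (-((gprod o (a.seq i) (b.seq i) : ℝ) : EReal))) atTop
      (𝓝 ((bourdon o).d a b)) :=
    (ENNReal.continuous_exp.tendsto _).comp
      ((continuous_neg.tendsto _).comp (tendsto_bgprod_seq o a b))
  have h2 := (ENNReal.tendsto_toReal hne).comp h1
  refine h2.congr fun i => ?_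
  simp only [Function.comp]
  rw [← EReal.coe_neg, EReal.exp_coe, ENNReal.toReal_ofReal (Real.exp_nonneg _)]

/-- The Busemann function `B_a(x,y) = lim (|x a i| - |y a i|)` exists. -/
theorem exists_busemann (x y : X) (a : Boundary X) :
    ∃ B : ℝ, Tendsto (fun i => dist x (a.seq i) - dist y (a.seq i)) atTop (𝓝 B) := by
  obtain ⟨N, hN⟩ := (Quotient.out a).2.exists_forall y (dist y x)
  refine ⟨dist x (a.seq N) - dist y (a.seq N), tendsto_const_nhds.congr' ?_⟩
  filter_upwards [eventually_ge_atTop N] with i hi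
  have h1 := hN N le_rfl i hi
  have h2 := hN i hi N le_rfl
  change _ < gprod y (a.seq N) (a.seq i) at h1
  change _ < gprod y (a.seq i) (a.seq N) at h2
  have b1 := min_gprod_le y x (a.seq N) (a.seq i)
  have b2 := min_gprod_le y x (a.seq i) (a.seq N)
  have g1 := gprod_le_left y x (a.seq N)
  have g2 := gprod_le_left y x (a.seq i)
  rw [min_eq_left (by linarith)] at b1 b2
  unfold gprod at b1 b2
  linarith

/-- Bourdon metrics with different basepoints are Möbius equivalent. -/
theorem bourdon_equiv (x y : X) : MobiusEquivMetric (bourdon x) (bourdon y) := by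
  choose B hB using fun a : Boundary X => exists_busemann x y a
  have h : ∀ a b, (bourdon y).val a b =
      Real.exp (B a / 2) * Real.exp (B b / 2) * (bourdon x).val a b := by
    intro a b
    have hE : ∀ c : Boundary X, Tendsto
        (fun i => Real.exp ((dist x (c.seq i) - dist y (c.seq i)) / 2)) atTop
        (𝓝 (Real.exp (B c / 2))) :=
      fun c => (Real.continuous_exp.tendsto _).comp ((hB c).div_const 2)
    refine tendsto_nhds_unique (tendsto_bourdon y a b)
      ((((hE a).mul (hE b)).mul (tendsto_bourdon x a b)).congr fun i => ?_)
    rw [← Real.exp_add, ← Real.exp_add]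
    congr 1
    unfold gprod
    ring
  refine ⟨Function.injective_id, fun a b c d hq => ?_⟩
  unfold crt
  rw [Projectivization.mk_eq_mk_iff']
  refine ⟨Real.exp (B a / 2) * Real.exp (B b / 2) * Real.exp (B c / 2) * Real.exp (B d / 2), ?_⟩
  ext i
  fin_cases i <;> simp [crtVec, h] <;> ring

end BoundaryMetric

/-- The canonical Möbius structure on the boundary of a tree: the class of the Bourdon metrics
`ρ_o`, for any (equivalently, every) basepoint `o`. -/
def canonicalMobius (X : Type u) [MetricSpace X] [IsMetricTree X] :
    MobiusStructure (Boundary X) where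
  metrics := {ρ | ∀ o : X, MobiusEquivMetric (bourdon o) ρ}
  nonempty := by
    rcases isEmpty_or_nonempty X with hX | ⟨⟨o⟩⟩
    · have hE : IsEmpty (Boundary X) := ⟨fun a => hX.false (a.seq 0)⟩
      exact ⟨⟨fun _ _ => 0, ∅, subsingleton_empty, fun a => (hE.false a).elim,
        fun a => (hE.false a).elim, fun a => (hE.false a).elim, fun a => (hE.false a).elim,
        fun a => (hE.false a).elim, fun a => (hE.false a).elim⟩, fun o => (hX.false o).elim⟩
    · exact ⟨bourdon o, fun o' => bourdon_equiv o' o⟩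
  equivalent := by
    intro ρ h ρ' h'
    rcases isEmpty_or_nonempty X with hX | ⟨⟨o⟩⟩
    · exact ⟨Function.injective_id, fun a => (hX.false (a.seq 0)).elim⟩
    · exact (h o).symm.trans (h' o)
  maximal := fun ρ h o => h _ fun o' => bourdon_equiv o' o

end TreeMobius

end

noncomputable section

open Set Filter Topology
open scoped ENNReal LinearAlgebra.Projectivization

namespace TreeMobius

universe u v

/-! ### Gromov products of boundary points as real numbers. -/

section GromovProduct

variable {X : Type u} [MetricSpace X] [IsMetricTree X]

/-! A point `x` of a geodesically complete tree is encoded by the function `(a, b) ↦ (a|b)_x` on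
pairs of distinct ends, and the cross ratios decide which functions arise.

Composing one Möbius equivalence with the inverse of the other gives a bijection `f` of the
boundaries. Logarithms of cross ratios of Bourdon metrics are differences of Gromov products, so `f`
preserves these differences (`exists_preservesCrossDiff`).

Given `x`, choose a line through it with ends `a`, `b`, and a third end `c`. Let `x'` be the point
on the line from `f a` to `f b` with the same position relative to `f c`. Invariance of cross ratios
and 0-hyperbolicity then force all Gromov products at `x'` and `x` to agree
(`PreservesCrossDiff.exists_point`).

Distances are recovered from the encoding: `dist x y` is the maximum over ends of differences of
horofunctions, which are expressions in Gromov products. Hence `x ↦ x'` is isometric, and the same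
construction for `f.symm` gives surjectivity. -/

/-- The Gromov product of boundary points as a real number; it is meaningful only for distinct
points. -/
def realGprod (o : X) (a b : Boundary X) : ℝ := (bgprod o a b).toReal

/-- The boundary point represented by a Gromov sequence. -/
def Boundary.mk (s : ℕ → X) (hs : IsGromovSeq s) : Boundary X :=
  Quotient.mk (gromovSetoid X) ⟨s, hs⟩

theorem Boundary.exists_mk_eq (a : Boundary X) : ∃ s hs, Boundary.mk s hs = a := by
  obtain ⟨⟨s, hs⟩, h⟩ := Quotient.exists_rep a
  exact ⟨s, hs, h⟩

/-- The product is `⊤` only on the diagonal, where `toReal` would return the junk value 0; hence the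
distinctness hypotheses from here on. -/
theorem coe_realGprod (o : X) {a b : Boundary X} (h : a ≠ b) :
    ((realGprod o a b : ℝ) : EReal) = bgprod o a b := by
  refine EReal.coe_toReal (fun h' => h ((bgprod_eq_top_iff o a b).1 h')) fun h' => ?_
  have := bgprod_nonneg o a b
  rw [h'] at this
  simp at this

theorem realGprod_comm (o : X) (a b : Boundary X) : realGprod o a b = realGprod o b a := by
  unfold realGprod
  rw [bgprod_comm]

theorem realGprod_nonneg (o : X) (a b : Boundary X) : 0 ≤ realGprod o a b :=
  EReal.toReal_nonneg (bgprod_nonneg o a b)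

theorem min_realGprod_le (o : X) {a b c : Boundary X} (hab : a ≠ b) (hbc : b ≠ c) (hac : a ≠ c) :
    min (realGprod o a b) (realGprod o b c) ≤ realGprod o a c := by
  have h := min_bgprod_le o a b c
  rw [← coe_realGprod o hab, ← coe_realGprod o hbc, ← coe_realGprod o hac,
    ← EReal.coe_strictMono.monotone.map_min] at h
  exact_mod_cast h

/-- Gromov products along sequences converging to distinct boundary points are eventually
constant. -/
theorem eventually_gprod_eq (o : X) {s t : ℕ → X} {hs : IsGromovSeq s} {ht : IsGromovSeq t}
    (h : Boundary.mk s hs ≠ Boundary.mk t ht) :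
    ∀ᶠ i in atTop, gprod o (s i) (t i) = realGprod o (Boundary.mk s hs) (Boundary.mk t ht) := by
  have h1 := tendsto_bgprod o ⟨s, hs⟩ ⟨t, ht⟩
  change Tendsto _ _ (𝓝 (bgprod o (Boundary.mk s hs) (Boundary.mk t ht))) at h1
  rw [← coe_realGprod o h] at h1
  have h2 : Tendsto (fun i => gprod o (s i) (t i)) atTop
      (𝓝 (realGprod o (Boundary.mk s hs) (Boundary.mk t ht))) := EReal.tendsto_coe.1 h1
  -- In a tree the products either diverge or stabilize; a finite limit leaves only the second case.
  rcases tendsto_or_eventually_const hs ht o with h3 | ⟨L, h3⟩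
  · exact absurd h2 (not_tendsto_nhds_of_tendsto_atTop h3 _)
  · have h4 : Tendsto (fun i => gprod o (s i) (t i)) atTop (𝓝 L) :=
      tendsto_const_nhds.congr' (h3.mono fun i hi => hi.symm)
    rwa [tendsto_nhds_unique h2 h4]

/-! ### Horofunctions and distances. -/

/-- The horofunction of `a` normalized by `b` and `c`: the limit of `d(o, a i) - (b | c)_{a i}`
along a sequence `a i` converging to `a`. -/
def horo (o : X) (a b c : Boundary X) : ℝ :=
  realGprod o a b + realGprod o a c - realGprod o b c

/-- The normalizing term `(b|c)_{a i}` does not involve the basepoint and cancels in the difference.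
Equality holds at finite stages because all six Gromov products stabilize. -/
theorem eventually_horo_sub_horo (x y : X) {s : ℕ → X} {hs : IsGromovSeq s} {b c : Boundary X}
    (hb : Boundary.mk s hs ≠ b) (hc : Boundary.mk s hs ≠ c) (hbc : b ≠ c) :
    ∀ᶠ i in atTop, dist x (s i) - dist y (s i) =
      horo x (Boundary.mk s hs) b c - horo y (Boundary.mk s hs) b c := by
  obtain ⟨t, ht, rfl⟩ := b.exists_mk_eq
  obtain ⟨r, hr, rfl⟩ := c.exists_mk_eq
  filter_upwards [eventually_gprod_eq x hb, eventually_gprod_eq x hc, eventually_gprod_eq x hbc,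
    eventually_gprod_eq y hb, eventually_gprod_eq y hc, eventually_gprod_eq y hbc]
    with i h1 h2 h3 h4 h5 h6
  unfold horo
  rw [← h1, ← h2, ← h3, ← h4, ← h5, ← h6]
  unfold gprod
  ring

/-- This is the triangle inequality with a third vertex far out towards `a`. -/
theorem horo_sub_horo_le (x y : X) {a b c : Boundary X} (hb : a ≠ b) (hc : a ≠ c) (hbc : b ≠ c) :
    horo x a b c - horo y a b c ≤ dist x y := by
  obtain ⟨s, hs, rfl⟩ := a.exists_mk_eq
  obtain ⟨i, hi⟩ := (eventually_horo_sub_horo x y hb hc hbc).exists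
  rw [← hi]
  linarith [dist_triangle x y (s i)]

/-- Along a line, the Gromov product of `g i` and `g j` based at `g 0` is `min i j`. -/
theorem isGromovSeq_of_isometry {Y : Type*} [MetricSpace Y] {g : ℝ → Y} (hg : Isometry g) :
    IsGromovSeq fun i : ℕ => g i := by
  refine ⟨g 0, tendsto_atTop.2 fun C => ?_⟩
  obtain ⟨N, hN⟩ := exists_nat_ge C
  refine eventually_atTop.2 ⟨(N, N), fun p hp => ?_⟩
  have h1 : (N : ℝ) ≤ p.1 := by exact_mod_cast hp.1
  have h2 : (N : ℝ) ≤ p.2 := by exact_mod_cast hp.2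
  have h3 : (0 : ℝ) ≤ N := N.cast_nonneg
  simp only [gprod, hg.dist_eq, Real.dist_eq]
  rw [abs_of_nonpos (by linarith), abs_of_nonpos (by linarith)]
  rcases abs_cases ((p.1 : ℝ) - p.2) with ⟨h, -⟩ | ⟨h, -⟩ <;> rw [h] <;> linarith

theorem exists_isometry_of_ne (hX : IsGeodesicallyComplete X) {x y : X} (h : x ≠ y) :
    ∃ g : ℝ → X, Isometry g ∧ g 0 = x ∧ g (dist x y) = y := by
  obtain ⟨c, ⟨hc, h0, h1⟩, -⟩ := IsMetricTree.existsUnique_geodesic x y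
  obtain ⟨g, hg, hgc⟩ := hX _ (dist_pos.2 h) c hc
  exact ⟨g, hg, (hgc ⟨0, le_rfl, dist_nonneg⟩).trans h0,
    (hgc ⟨dist x y, dist_nonneg, le_rfl⟩).trans h1⟩

/-- In a geodesically complete tree, distances are attained by differences of horofunctions. -/
theorem exists_horo_sub_horo_eq (hX : IsGeodesicallyComplete X) {x y : X} (h : x ≠ y) :
    ∃ a : Boundary X, ∀ b c, a ≠ b → a ≠ c → b ≠ c → horo x a b c - horo y a b c = dist x y := by
  obtain ⟨g, hg, h0, h1⟩ := exists_isometry_of_ne hX h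
  refine ⟨Boundary.mk _ (isGromovSeq_of_isometry hg), fun b c hb hc hbc => ?_⟩
  -- The line runs from `x` through `y` to the end `a`; for `i ≥ dist x y` the point `g i` lies
  -- beyond `y`, so the two distances differ by exactly `dist x y`.
  obtain ⟨N, hN⟩ := exists_nat_ge (dist x y)
  obtain ⟨i, hi, hiN⟩ :=
    ((eventually_horo_sub_horo x y hb hc hbc).and (eventually_ge_atTop N)).exists
  have h2 : (N : ℝ) ≤ i := by exact_mod_cast hiN
  have h3 := dist_nonneg (x := x) (y := y)
  rw [← hi]
  have e1 : dist x (g i) = i := by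
    rw [← h0, hg.dist_eq, Real.dist_eq, abs_of_nonpos (by linarith)]
    ring
  have e2 : dist y (g i) = i - dist x y := by
    conv_lhs => rw [← h1]
    rw [hg.dist_eq, Real.dist_eq, abs_of_nonpos (by linarith)]
    ring
  rw [e1, e2]
  ring

/-- In a one-point space all Gromov products vanish, so there are no Gromov sequences. -/
theorem exists_ne_of_boundary (a : Boundary X) (x : X) : ∃ y, x ≠ y := by
  by_contra! h
  obtain ⟨s, hs, -⟩ := a.exists_mk_eq
  obtain ⟨N, hN⟩ := hs.exists_forall x 0
  have := hN N le_rfl N le_rfl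
  simp [gprod, ← h] at this

/-- In a geodesically complete tree, every point lies on a line. -/
theorem exists_realGprod_eq_zero (hX : IsGeodesicallyComplete X) [Nonempty (Boundary X)] (x : X) :
    ∃ a b : Boundary X, a ≠ b ∧ realGprod x a b = 0 := by
  obtain ⟨y, hy⟩ := exists_ne_of_boundary (Classical.arbitrary (Boundary X)) x
  obtain ⟨g, hg, h0, -⟩ := exists_isometry_of_ne hX hy
  -- Reversing the line yields its other end.
  have hg' : Isometry fun t => g (-t) := hg.comp (IsometryEquiv.neg ℝ).isometry
  have h := tendsto_bgprod x ⟨_, isGromovSeq_of_isometry hg⟩ ⟨_, isGromovSeq_of_isometry hg'⟩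
  have hz : ∀ i : ℕ, gprod x (g i) (g (-i)) = 0 := by
    intro i
    have hi : (0 : ℝ) ≤ i := i.cast_nonneg
    rw [← h0]
    simp only [gprod, hg.dist_eq, Real.dist_eq]
    rw [abs_of_nonpos (by linarith), abs_of_nonneg (by linarith), abs_of_nonneg (by linarith)]
    ring
  simp only [hz] at h
  have h2 := tendsto_nhds_unique h tendsto_const_nhds
  refine ⟨Boundary.mk _ (isGromovSeq_of_isometry hg), Boundary.mk _ (isGromovSeq_of_isometry hg'),
    fun hab => ?_, ?_⟩
  -- Equal ends would have product `⊤`, not 0.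
  · have := ((bgprod_eq_top_iff x _ _).2 hab).symm.trans h2
    simp at this
  · exact congrArg EReal.toReal h2

/-! ### Points with prescribed position on the line between two ends. -/

theorem exists_mem_geodSegment {x y : X} {t : ℝ} (h0 : 0 ≤ t) (h1 : t ≤ dist x y) :
    ∃ p : X, dist x p = t ∧ dist p y = dist x y - t := by
  obtain ⟨c, ⟨hc, hx, hy⟩, -⟩ := IsMetricTree.existsUnique_geodesic x y
  refine ⟨c ⟨t, h0, h1⟩, ?_, ?_⟩
  · have := hc.dist_eq ⟨0, le_rfl, dist_nonneg⟩ ⟨t, h0, h1⟩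
    rw [hx, Subtype.dist_eq, Real.dist_eq, abs_of_nonpos (by simpa using h0)] at this
    simpa using this
  · have := hc.dist_eq ⟨t, h0, h1⟩ ⟨dist x y, dist_nonneg, le_rfl⟩
    rw [hy, Subtype.dist_eq, Real.dist_eq, abs_of_nonpos (by simpa using h1)] at this
    simpa using this

/-- If `y` and `z` are in the same direction from `p`, farther than `o` is from `p`, then
`o` does not distinguish them. -/
theorem dist_sub_dist_eq {o p y z : X} (h : dist p o ≤ gprod p y z) :
    dist p y - dist o y = dist p z - dist o z := by
  have b1 := min_gprod_le p o y z
  have b2 := min_gprod_le p o z y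
  have g1 := gprod_le_left p o y
  have g2 := gprod_le_left p o z
  rw [gprod_comm p z y] at b2
  -- Both `(o|y)_p` and `(o|z)_p` are at most `dist p o ≤ (y|z)_p`, so each minimum is the term with
  -- `o`, and the two inequalities give `(o|y)_p = (o|z)_p`.
  rw [min_eq_left (by linarith)] at b1 b2
  unfold gprod at b1 b2
  linarith

/-- Two distinct boundary points are joined by a line, and a point of this line may be prescribed
by its position relative to a third boundary point. -/
theorem exists_realGprod_eq_zero_and_sub_eq [Nonempty X] {a b c : Boundary X} (hab : a ≠ b)
    (hac : a ≠ c) (hbc : b ≠ c) (s : ℝ) :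
    ∃ p : X, realGprod p a b = 0 ∧ realGprod p a c - realGprod p b c = s := by
  obtain ⟨α, hα, rfl⟩ := a.exists_mk_eq
  obtain ⟨β, hβ, rfl⟩ := b.exists_mk_eq
  obtain ⟨γ, hγ, rfl⟩ := c.exists_mk_eq
  obtain ⟨o⟩ := ‹Nonempty X›
  set G := realGprod o (Boundary.mk α hα) (Boundary.mk β hβ) with hG
  -- Passing from `o` to `p` changes `(a|c) - (b|c)` by half the change of `d(·, α) - d(·, β)`, so
  -- `r` is the required change of the latter.
  set r := 2 * s - 2 * (realGprod o (Boundary.mk α hα) (Boundary.mk γ hγ) -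
    realGprod o (Boundary.mk β hβ) (Boundary.mk γ hγ)) with hr
  have hG0 : 0 ≤ G := realGprod_nonneg _ _ _
  have hr0 := abs_nonneg r
  have hr1 := le_abs_self r
  have hr2 := neg_abs_le r
  obtain ⟨N₁, h₁⟩ := hα.exists_forall o (2 * (G + |r|))
  obtain ⟨N₂, h₂⟩ := hβ.exists_forall o (2 * (G + |r|))
  obtain ⟨N₃, h₃⟩ := eventually_atTop.1 (eventually_gprod_eq o hab)
  set N := max N₁ (max N₂ N₃)
  have hN₁ : N₁ ≤ N := le_max_left _ _
  have hN₂ : N₂ ≤ N := (le_max_left _ _).trans (le_max_right _ _)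
  have hN₃ : N₃ ≤ N := (le_max_right _ _).trans (le_max_right _ _)
  have eG := h₃ N hN₃
  rw [← hG] at eG
  have dα := (h₁ N hN₁ N hN₁).trans_le (gprod_le_left _ _ _)
  have dβ := (h₂ N hN₂ N hN₂).trans_le (gprod_le_left _ _ _)
  have eG' : dist (α N) (β N) = dist o (α N) + dist o (β N) - 2 * G := by
    rw [← eG]
    unfold gprod
    ring
  -- The parameter solves `d(p, α N) - d(p, β N) = d(o, α N) - d(o, β N) + r` on the segment; it
  -- equals `d(o, α N) - G + r/2`, which is admissible since `α N` and `β N` are far from `o`.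
  obtain ⟨p, hp1, hp2⟩ := exists_mem_geodSegment (x := α N) (y := β N)
    (t := (dist (α N) (β N) + r + dist o (α N) - dist o (β N)) / 2)
    (by rw [eG']; linarith) (by rw [eG']; linarith)
  rw [dist_comm] at hp1
  -- This bound does not depend on `N`, so the threshold `2 * (G + |r|)` keeps the tails of `α` and
  -- `β` in a fixed direction from `p`, beyond the reach of `o`.
  have hop : dist p o ≤ G + |r| / 2 := by
    have h4 := min_gprod_le o (α N) p (β N)
    rw [eG, min_le_iff] at h4
    unfold gprod at h4
    rw [dist_comm p o, dist_comm (α N) p] at *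
    rcases h4 with h4 | h4 <;> linarith
  have hαp : ∀ j ≥ N, dist p o ≤ gprod p (α N) (α j) ∧ 0 < gprod p (α N) (α j) := by
    intro j hj
    have h5 := h₁ N hN₁ j (hN₁.trans hj)
    have h6 := gprod_base o p (α N) (α j)
    rw [dist_comm o p] at h6
    constructor <;> linarith
  have hβp : ∀ j ≥ N, dist p o ≤ gprod p (β N) (β j) ∧ 0 < gprod p (β N) (β j) := by
    intro j hj
    have h5 := h₂ N hN₂ j (hN₂.trans hj)
    have h6 := gprod_base o p (β N) (β j)
    rw [dist_comm o p] at h6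
    constructor <;> linarith
  have hpN : gprod p (α N) (β N) = 0 := by
    unfold gprod
    linarith
  -- Replace `α N` by `α j`, then `β N` by `β j`: in each 0-hyperbolic inequality the product within
  -- one tail is positive, so the other one must vanish.
  have hpj : ∀ j ≥ N, gprod p (α j) (β j) = 0 := by
    intro j hj
    have h5 := min_gprod_le p (α N) (α j) (β N)
    have h6 := min_gprod_le p (α j) (β j) (β N)
    have h7 := (hαp j hj).2
    have h8 := (hβp j hj).2
    have h9 := gprod_nonneg p (α j) (β j)
    rw [gprod_comm p (β j) (β N)] at h6
    rw [min_le_iff] at h5 h6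
    rcases h5 with h5 | h5 <;> rcases h6 with h6 | h6 <;> linarith
  refine ⟨p, ?_, ?_⟩
  · obtain ⟨j, hj, hjN⟩ :=
      ((eventually_gprod_eq p hab).and (eventually_ge_atTop N)).exists
    rw [← hj, hpj j hjN]
  · obtain ⟨j, hjN, e1, e2, e3, e4⟩ := ((eventually_ge_atTop N).and
      ((eventually_gprod_eq p hac).and ((eventually_gprod_eq p hbc).and
      ((eventually_gprod_eq o hac).and (eventually_gprod_eq o hbc))))).exists
    -- The differences `d(p, ·) - d(o, ·)` are the same at index `j` as at `N`, where `p` was fixed.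
    have k1 := dist_sub_dist_eq (hαp j hjN).1
    have k2 := dist_sub_dist_eq (hβp j hjN).1
    rw [← e1, ← e2]
    rw [← e3, ← e4] at hr
    unfold gprod at hr ⊢
    linarith

theorem val_bourdon (o : X) {a b : Boundary X} (h : a ≠ b) :
    (bourdon o).val a b = Real.exp (-realGprod o a b) := by
  have hne : (bourdon o).d a b ≠ ∞ :=
    (bourdon o).d_ne_top a b (notMem_empty _) (notMem_empty _)
  rw [ExtMetric.val, if_neg hne]
  change (EReal.exp (-bgprod o a b)).toReal = _
  rw [← coe_realGprod o h, ← EReal.coe_neg, EReal.exp_coe,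
    ENNReal.toReal_ofReal (Real.exp_nonneg _)]

theorem bourdon_mem_canonicalMobius (o : X) : bourdon o ∈ (canonicalMobius X).metrics :=
  fun o' => bourdon_equiv o' o

end GromovProduct

/-! ### Boundary bijections preserving cross ratios. -/

variable {X : Type u} [MetricSpace X] [IsMetricTree X]
  {X' : Type v} [MetricSpace X'] [IsMetricTree X']

/-- The map `f` between the boundaries preserves the differences of Gromov products that make up
the cross ratio. -/
def PreservesCrossDiff (f : Boundary X ≃ Boundary X') : Prop :=
  ∀ (x : X) (x' : X') (a b c d : Boundary X),
    a ≠ b → a ≠ c → a ≠ d → b ≠ c → b ≠ d → c ≠ d →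
    realGprod x' (f a) (f b) + realGprod x' (f c) (f d)
        - (realGprod x' (f a) (f c) + realGprod x' (f b) (f d)) =
      realGprod x a b + realGprod x c d - (realGprod x a c + realGprod x b d)

theorem PreservesCrossDiff.symm {f : Boundary X ≃ Boundary X'} (hf : PreservesCrossDiff f) :
    PreservesCrossDiff f.symm := by
  intro x' x a b c d hab hac had hbc hbd hcd
  have := hf x x' (f.symm a) (f.symm b) (f.symm c) (f.symm d)
    (by simpa) (by simpa) (by simpa) (by simpa) (by simpa) (by simpa)
  simp only [Equiv.apply_symm_apply] at this
  exact this.symm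

/-- Both equivalences are compared with the same metric `ρ` on `Z`, so the triples of `bourdon x`
and `bourdon x'` agree under `f`. The logarithm of the quotient of their first two entries is the
asserted difference. -/
theorem exists_preservesCrossDiff {Z : Type*} {M : MobiusStructure Z}
    (h : (canonicalMobius X).Equivalent M) (h' : (canonicalMobius X').Equivalent M) :
    ∃ f : Boundary X ≃ Boundary X', PreservesCrossDiff f := by
  obtain ⟨g, hg, hgM⟩ := h
  obtain ⟨g', hg', hgM'⟩ := h'
  obtain ⟨ρ, hρ⟩ := M.nonempty
  let f : Boundary X ≃ Boundary X' := (Equiv.ofBijective g hg).trans (Equiv.ofBijective g' hg').symm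
  have hf : ∀ a, g' (f a) = g a := fun a =>
    (Equiv.ofBijective g' hg').apply_symm_apply (Equiv.ofBijective g hg a)
  refine ⟨f, fun x x' a b c d hab hac had hbc hbd hcd => ?_⟩
  obtain ⟨_, h1⟩ := hgM _ (bourdon_mem_canonicalMobius x) ρ hρ
  obtain ⟨_, h2⟩ := hgM' _ (bourdon_mem_canonicalMobius x') ρ hρ
  have hq : Admissible a b c d := by unfold Admissible; tauto
  have e1 := h1 a b c d hq
  have e2 := h2 (f a) (f b) (f c) (f d) (hq.map f.injective)
  simp only [hf] at e2
  have e3 := e1.symm.trans e2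
  unfold crt at e3
  rw [Projectivization.mk_eq_mk_iff'] at e3
  obtain ⟨k, hk⟩ := e3
  have k0 := congrFun hk 0
  have k1 := congrFun hk 1
  have fne : ∀ {p q}, p ≠ q → f p ≠ f q := fun h => f.injective.ne h
  simp only [crtVec, Matrix.cons_val, Pi.smul_apply, smul_eq_mul, val_bourdon x hab,
    val_bourdon x hcd, val_bourdon x hac, val_bourdon x hbd, val_bourdon x' (fne hab),
    val_bourdon x' (fne hcd), val_bourdon x' (fne hac), val_bourdon x' (fne hbd),
    ← Real.exp_add] at k0 k1
  have hk0 : k ≠ 0 := by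
    rintro rfl
    rw [zero_mul] at k0
    exact (Real.exp_pos _).ne k0
  -- The unknown scalar contributes the same `Real.log k` to both equations and drops out.
  have l0 := congrArg Real.log k0
  have l1 := congrArg Real.log k1
  rw [Real.log_mul hk0 (Real.exp_ne_zero _), Real.log_exp, Real.log_exp] at l0 l1
  linarith

/-- A point of a geodesically complete tree is transported by a boundary map that preserves cross
ratios: there is a point of the other tree with the same Gromov products. -/
theorem PreservesCrossDiff.exists_point {f : Boundary X ≃ Boundary X'}
    (hf : PreservesCrossDiff f) (hX : IsNonelementary X) (hXgc : IsGeodesicallyComplete X)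
    (x : X) : ∃ x' : X', ∀ p q, p ≠ q → realGprod x' (f p) (f q) = realGprod x p q := by
  have hne : Nonempty (Boundary X) := by
    rw [← Cardinal.mk_ne_zero_iff]
    rintro h
    rw [IsNonelementary, h] at hX
    simp at hX
  obtain ⟨a, b, hab, h0⟩ := exists_realGprod_eq_zero hXgc x
  obtain ⟨c, hca, hcb⟩ := Cardinal.exists_ne_ne_of_three_le hX a b
  have hac := hca.symm
  have hbc := hcb.symm
  have : Nonempty X' := ⟨(f a).seq 0⟩
  obtain ⟨x', h0', hs⟩ := exists_realGprod_eq_zero_and_sub_eq (f.injective.ne hab)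
    (f.injective.ne hac) (f.injective.ne hbc) (realGprod x a c - realGprod x b c)
  refine ⟨x', ?_⟩
  -- The cross ratio of `a, p, c, b` compares the position of `p` along the line with that of `c`,
  -- which was matched by the choice of `x'`.
  have hsub : ∀ p, a ≠ p → b ≠ p → realGprod x' (f a) (f p) - realGprod x' (f b) (f p) =
      realGprod x a p - realGprod x b p := by
    intro p hap hbp
    by_cases hpc : p = c
    · rw [hpc, hs]
    · have := hf x x' a p c b hap hac hab hpc hbp.symm hbc.symm
      simp only [realGprod_comm x p b, realGprod_comm x c b, realGprod_comm x' (f p) (f b),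
        realGprod_comm x' (f c) (f b)] at this
      linarith
  -- Since `(a|b)_x = 0`, one of the nonnegative numbers `(a|p)_x`, `(b|p)_x` vanishes; such a pair
  -- is determined by its difference. The same holds at `x'`.
  have hzero : ∀ p, a ≠ p → b ≠ p → realGprod x' (f a) (f p) = realGprod x a p ∧
      realGprod x' (f b) (f p) = realGprod x b p := by
    intro p hap hbp
    have h1 := hsub p hap hbp
    have h2 := min_realGprod_le x hap hbp.symm hab
    have h3 := min_realGprod_le x' (f.injective.ne hap) (f.injective.ne hbp.symm)
      (f.injective.ne hab)
    rw [realGprod_comm x p b, h0, min_le_iff] at h2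
    rw [realGprod_comm x' (f p) (f b), h0', min_le_iff] at h3
    have p1 := realGprod_nonneg x a p
    have p2 := realGprod_nonneg x b p
    have p3 := realGprod_nonneg x' (f a) (f p)
    have p4 := realGprod_nonneg x' (f b) (f p)
    constructor <;> rcases h2 with h2 | h2 <;> rcases h3 with h3 | h3 <;> linarith
  intro p q hpq
  by_cases hap : a = p
  · subst hap
    by_cases hbq : b = q
    · rw [← hbq, h0, h0']
    · exact (hzero q hpq hbq).1
  by_cases hbp : b = p
  · subst hbp
    by_cases haq : a = q
    · rw [← haq, realGprod_comm x', realGprod_comm x, h0, h0']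
    · exact (hzero q haq hpq).2
  by_cases haq : a = q
  · rw [← haq, realGprod_comm x', realGprod_comm x, (hzero p hap hbp).1]
  by_cases hbq : b = q
  · rw [← hbq, realGprod_comm x', realGprod_comm x, (hzero p hap hbp).2]
  -- In this cross ratio every product except `(p|q)` is already matched.
  have h1 := hf x x' a b p q hab hap haq hbp hbq hpq
  rw [(hzero p hap hbp).1, (hzero q haq hbq).2, h0, h0'] at h1
  linarith

/-! ### From boundary maps to isometries. -/

/-- Points of a geodesically complete tree are at most as far apart as points of another tree with
the same Gromov products. -/
theorem dist_le_dist_of_realGprod_eq (f : Boundary X ≃ Boundary X') (hX : IsNonelementary X)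
    (hXgc : IsGeodesicallyComplete X) {x y : X} {x' y' : X'}
    (hx : ∀ p q, p ≠ q → realGprod x' (f p) (f q) = realGprod x p q)
    (hy : ∀ p q, p ≠ q → realGprod y' (f p) (f q) = realGprod y p q) :
    dist x y ≤ dist x' y' := by
  rcases eq_or_ne x y with rfl | hxy
  · simp
  -- An end realizing `dist x y` in `X` gives the same horofunction difference in `X'`, where it is
  -- at most `dist x' y'`.
  obtain ⟨a, ha⟩ := exists_horo_sub_horo_eq hXgc hxy
  obtain ⟨b, hba, -⟩ := Cardinal.exists_ne_ne_of_three_le hX a a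
  have hab := hba.symm
  obtain ⟨c, hca, hcb⟩ := Cardinal.exists_ne_ne_of_three_le hX a b
  have hac := hca.symm
  have hbc := hcb.symm
  have h := horo_sub_horo_le x' y' (f.injective.ne hab) (f.injective.ne hac) (f.injective.ne hbc)
  rw [← ha b c hab hac hbc]
  unfold horo at h ⊢
  rwa [hx a b hab, hx a c hac, hx b c hbc, hy a b hab, hy a c hac, hy b c hbc] at h

theorem PreservesCrossDiff.nonempty_isometryEquiv {f : Boundary X ≃ Boundary X'}
    (hf : PreservesCrossDiff f) (hX : IsNonelementary X) (hXgc : IsGeodesicallyComplete X)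
    (hX' : IsNonelementary X') (hXgc' : IsGeodesicallyComplete X') : Nonempty (X ≃ᵢ X') := by
  choose φ hφ using hf.exists_point hX hXgc
  have hinv : ∀ (x : X) (x' : X'),
      (∀ p q, p ≠ q → realGprod x' (f p) (f q) = realGprod x p q) →
      ∀ p q, p ≠ q → realGprod x (f.symm p) (f.symm q) = realGprod x' p q := by
    intro x x' h p q hpq
    rw [← h _ _ (f.symm.injective.ne hpq), f.apply_symm_apply, f.apply_symm_apply]
  have hiso : Isometry φ := Isometry.of_dist_eq fun x y => le_antisymm
    (dist_le_dist_of_realGprod_eq f.symm hX' hXgc' (hinv _ _ (hφ x)) (hinv _ _ (hφ y)))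
    (dist_le_dist_of_realGprod_eq f hX hXgc (hφ x) (hφ y))
  have hsurj : Function.Surjective φ := by
    intro x'
    -- Both `φ x` and `x'` have the Gromov products of `x`, so their distance is at most `dist x x =
    -- 0`.
    obtain ⟨x, hx⟩ := hf.symm.exists_point hX' hXgc' x'
    refine ⟨x, dist_le_zero.1 ?_⟩
    rw [← dist_self x]
    exact dist_le_dist_of_realGprod_eq f.symm hX' hXgc' (hinv _ _ (hφ x)) hx
  exact ⟨IsometryEquiv.mk' φ (Function.surjInv hsurj) (Function.surjInv_eq hsurj) hiso⟩

end TreeMobius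

end

theorem corollary4p4 {Z : Type*} (hZ : 3 ≤ Cardinal.mk Z) (M : TreeMobius.MobiusStructure Z)
    (hultra : M.IsUltrametric) (hcomplete : M.IsComplete)
    {X : Type*} [MetricSpace X] [TreeMobius.IsMetricTree X]
    (hX : TreeMobius.IsNonelementary X) (hXgc : TreeMobius.IsGeodesicallyComplete X)
    (hXM : (TreeMobius.canonicalMobius X).Equivalent M)
    {X' : Type*} [MetricSpace X'] [TreeMobius.IsMetricTree X']
    (hX' : TreeMobius.IsNonelementary X') (hXgc' : TreeMobius.IsGeodesicallyComplete X')
    (hXM' : (TreeMobius.canonicalMobius X').Equivalent M) :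
    Nonempty (X ≃ᵢ X') := by
  obtain ⟨f, hf⟩ := TreeMobius.exists_preservesCrossDiff hXM hXM'
  exact hf.nonempty_isometryEquiv hX hXgc hX' hXgc'
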